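/- Let $H=\{z\in\mathbb C:\operatorname{Im} z>0\}$. For an integer $k\ge 1$ and $\tau,\sigma\in H$, put $q=e^{2\pi i\tau}$, $r=e^{2\pi i\sigma}$ and define the elliptic zeta value by the absolutely convergent series \[ Z_k(\tau,\sigma)=-\frac{(2\pi i)^k}{(k-1)!}\sum_{j=1}^\infty j^{k-1}\,\frac{q^j-(-1)^k r^j}{(1-q^j)(1-r^j)} . \] Let $1\le k\le 3$ and suppose $\tau,\sigma,\sigma/\tau\in H$. Then \[ Z_k(\tau,\sigma)=Z_k(\tau,\tau+\sigma)+Z_k(\tau+\sigma,\sigma), \] \[ Z_k(\tau,\sigma)=\tau^{-k}Z_k\left(-\frac1\tau,\frac\sigma\tau\right)+(-\sigma)^{-k}Z_k\left(-\frac\tau\sigma,-\frac1\sigma\right)+i\pi a_k, \] where \[ a_1=-\frac12+\frac1{2\tau}-\frac1{2\sigma}+\frac{\sigma}{6\tau}+\frac{\tau}{6\sigma}+\frac1{6\tau\sigma},\qquad a_2=-\frac1\tau+\frac1\sigma-\frac1{\tau\sigma},\qquad a_3=\frac1{\tau\sigma}. \] -/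

import Mathlib

noncomputable section

/-- The `j`-th term `j ^ (k - 1) * (q ^ j - (-1) ^ k * r ^ j) / ((1 - q ^ j) * (1 - r ^ j))` of the
series that defines the elliptic zeta value, where `q = exp (2πiτ)` and `r = exp (2πiσ)`. -/
def ellipticZetaTerm (k : ℕ) (τ σ : ℂ) (j : ℕ+) : ℂ :=
  ((j : ℕ) : ℂ) ^ (k - 1) *
    ((Complex.exp (2 * Real.pi * Complex.I * τ) ^ (j : ℕ)
        - (-1) ^ k * Complex.exp (2 * Real.pi * Complex.I * σ) ^ (j : ℕ)) /
      ((1 - Complex.exp (2 * Real.pi * Complex.I * τ) ^ (j : ℕ)) *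
        (1 - Complex.exp (2 * Real.pi * Complex.I * σ) ^ (j : ℕ))))

/-- The elliptic zeta value `Z_k(τ, σ)`, for `k ≥ 1` and `τ`, `σ` in the upper half-plane. -/
def ellipticZeta (k : ℕ) (τ σ : ℂ) : ℂ :=
  -((2 * Real.pi * Complex.I) ^ k / ((k - 1).factorial : ℂ)) * ∑' j : ℕ+, ellipticZetaTerm k τ σ j

/-- The rational functions `a_1`, `a_2`, `a_3` of `τ` and `σ` (only `k = 1, 2, 3` are meaningful). -/
def exceptionalCorrection (k : ℕ) (τ σ : ℂ) : ℂ :=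
  match k with
  | 1 => -(1 / 2) + 1 / (2 * τ) - 1 / (2 * σ) + σ / (6 * τ) + τ / (6 * σ) + 1 / (6 * τ * σ)
  | 2 => -(1 / τ) + 1 / σ - 1 / (τ * σ)
  | 3 => 1 / (τ * σ)
  | _ => 0

theorem norm_exp_two_pi_I_mul_lt_one {τ : ℂ} (hτ : 0 < τ.im) :
    ‖Complex.exp (2 * Real.pi * Complex.I * τ)‖ < 1 := by
  rw [Complex.norm_exp, Real.exp_lt_one_iff]
  have h : (2 * Real.pi * Complex.I * τ).re = -(2 * Real.pi * τ.im) := by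
    simp [Complex.mul_re, Complex.mul_im]
  rw [h]
  have := Real.pi_pos
  have : 0 < 2 * Real.pi * τ.im := by positivity
  linarith

theorem one_sub_norm_le_norm_one_sub_pow {q : ℂ} (hq : ‖q‖ < 1) (j : ℕ+) :
    1 - ‖q‖ ≤ ‖1 - q ^ (j : ℕ)‖ := by
  have h1 : ‖q ^ (j : ℕ)‖ ≤ ‖q‖ := by
    rw [norm_pow]
    exact pow_le_of_le_one (norm_nonneg _) hq.le j.pos.ne'
  have h2 := norm_sub_norm_le (1 : ℂ) (q ^ (j : ℕ))
  rw [norm_one] at h2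
  linarith

theorem summable_ellipticZetaTerm_aux (k : ℕ) {q r : ℂ} (hq : ‖q‖ < 1) (hr : ‖r‖ < 1) :
    Summable fun j : ℕ+ => ((j : ℕ) : ℂ) ^ (k - 1) *
      ((q ^ (j : ℕ) - (-1) ^ k * r ^ (j : ℕ)) / ((1 - q ^ (j : ℕ)) * (1 - r ^ (j : ℕ)))) := by
  have hs : Summable fun n : ℕ => ((n : ℝ) ^ (k - 1) * ‖q‖ ^ n + (n : ℝ) ^ (k - 1) * ‖r‖ ^ n) *
      ((1 - ‖q‖) * (1 - ‖r‖))⁻¹ :=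
    ((summable_pow_mul_geometric_of_norm_lt_one (k - 1)
        (show ‖(‖q‖ : ℝ)‖ < 1 by rwa [norm_norm])).add
      (summable_pow_mul_geometric_of_norm_lt_one (k - 1)
        (show ‖(‖r‖ : ℝ)‖ < 1 by rwa [norm_norm]))).mul_right _
  refine Summable.of_norm_bounded (hs.comp_injective PNat.coe_injective) fun j => ?_
  have hq1 := one_sub_norm_le_norm_one_sub_pow hq j
  have hr1 := one_sub_norm_le_norm_one_sub_pow hr j
  have hq0 : 0 < 1 - ‖q‖ := by linarith
  have hr0 : 0 < 1 - ‖r‖ := by linarith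
  have hn : ‖q ^ (j : ℕ) - (-1) ^ k * r ^ (j : ℕ)‖ ≤ ‖q‖ ^ (j : ℕ) + ‖r‖ ^ (j : ℕ) := by
    refine (norm_sub_le _ _).trans (le_of_eq ?_)
    simp only [norm_mul, norm_pow, norm_neg, norm_one, one_pow, one_mul]
  have hd : ‖(1 - q ^ (j : ℕ)) * (1 - r ^ (j : ℕ))‖⁻¹ ≤ ((1 - ‖q‖) * (1 - ‖r‖))⁻¹ := by
    rw [norm_mul]
    exact inv_anti₀ (mul_pos hq0 hr0) (mul_le_mul hq1 hr1 hr0.le (norm_nonneg _))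
  rw [norm_mul, norm_div, norm_pow, Complex.norm_natCast, div_eq_mul_inv, ← mul_assoc]
  simp only [Function.comp]
  rw [← mul_add]
  exact mul_le_mul (mul_le_mul_of_nonneg_left hn (by positivity)) hd (by positivity)
    (by positivity)

/-- The series that defines the elliptic zeta value converges absolutely. -/
theorem summable_ellipticZetaTerm (k : ℕ) {τ σ : ℂ} (hτ : 0 < τ.im) (hσ : 0 < σ.im) :
    Summable (ellipticZetaTerm k τ σ) :=
  summable_ellipticZetaTerm_aux k (norm_exp_two_pi_I_mul_lt_one hτ)
    (norm_exp_two_pi_I_mul_lt_one hσ)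

end

/-!
The elliptic zeta value `Z_k(τ, σ)` is, up to a constant, the sum of the residues at the nonzero
integers of one meromorphic function, and the modular relation is the vanishing of the sum of all
residues of that function.

Let `φ(x) = 1 / (1 - exp (-2πix))` (`toddKernel`), and for complex numbers `a, b, c` let
`f(t) = t ^ (k - 1) * φ(at) * φ(bt) * φ(ct)` (`tripleProduct`). Its poles are the points `n / a`,
`n / b`, `n / c` with `n` an integer. For `(a, b, c) = (1, σ, -τ)` the residues at `n` and `-n` add up
to a constant multiple of the `n`-th term of the series for `Z_k(τ, σ)` (`tsum_tripleResidue`). Since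
`f` depends symmetrically on `a, b, c`, the other two families of poles give in the same way
`Z_k(-1/σ, -τ/σ)` and `Z_k(σ/τ, -1/τ)`, which `ellipticZeta_swap` turns into the values in the
relation. The pole at the origin gives the rational correction
(`exists_removableAt_tripleProduct_zero`).

The hypothesis that `τ`, `σ` and `σ / τ` lie in the upper half-plane says that `0` is interior to the
triangle with vertices `1, σ, -τ`, in counterclockwise order (`CyclicTriple`). Hence in every direction one of `at, bt, ct` has
imaginary part at least `δ|t|`. As `φ(x)` is bounded away from the integers, and `O(exp (-2π Im x))`
there, `f` decays exponentially away from its poles (`tendsto_mul_tripleProduct`).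

The residue theorem for the infinitely many poles is obtained from Liouville's theorem
(`CyclicTriple.sum_residues_eq_zero`). The residues decay exponentially, so the principal parts of `f`
can be summed. The difference `E` of `f` and this sum extends to an entire function, which tends to
`0` at infinity outside small discs around the poles, and by the maximum principle inside them as
well; hence `E = 0`. Outside the discs `t * E(t)` tends to minus the sum of all residues, which
therefore is zero.

The additive relation `Z_k(τ, σ) = Z_k(τ, τ + σ) + Z_k(τ + σ, σ)` holds term by term
(`ellipticZetaTerm_add`).
-/

/-! ### Removable singularities and sums of principal parts -/

section RemovableSingularities

open Filter Topology

/-- `f` agrees on a punctured neighbourhood of `z` with a function analytic at `z`. The value of `f`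
at `z` itself is irrelevant. -/
def RemovableAt (f : ℂ → ℂ) (z : ℂ) : Prop :=
  ∃ g : ℂ → ℂ, AnalyticAt ℂ g z ∧ f =ᶠ[𝓝[≠] z] g

theorem AnalyticAt.removableAt {f : ℂ → ℂ} {z : ℂ} (hf : AnalyticAt ℂ f z) : RemovableAt f z :=
  ⟨f, hf, EventuallyEq.rfl⟩

theorem RemovableAt.sub {f g : ℂ → ℂ} {z : ℂ} (hf : RemovableAt f z) (hg : RemovableAt g z) :
    RemovableAt (fun t => f t - g t) z := by
  obtain ⟨f', hf', h1⟩ := hf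
  obtain ⟨g', hg', h2⟩ := hg
  exact ⟨fun t => f' t - g' t, hf'.fun_sub hg', h1.sub h2⟩

/-- A function all of whose singularities are removable extends to an entire function. -/
theorem exists_differentiable_of_removableAt {f : ℂ → ℂ} (hf : ∀ z, RemovableAt f z) :
    ∃ F : ℂ → ℂ, Differentiable ℂ F ∧ ∀ z, AnalyticAt ℂ f z → F z = f z := by
  have key : ∀ z (g : ℂ → ℂ), AnalyticAt ℂ g z → f =ᶠ[𝓝[≠] z] g →
      limUnder (𝓝[≠] z) f = g z := fun z g hg hfg =>
    ((hg.continuousAt.tendsto.mono_left nhdsWithin_le_nhds).congr' hfg.symm).limUnder_eq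
  refine ⟨fun z => limUnder (𝓝[≠] z) f, fun z => ?_, fun z hz => key z f hz EventuallyEq.rfl⟩
  obtain ⟨g, hg, hfg⟩ := hf z
  have hloc : (fun w => limUnder (𝓝[≠] w) f) =ᶠ[𝓝 z] g := by
    have h1 : ∀ᶠ w in 𝓝 z, w ≠ z → f w = g w := eventually_nhdsWithin_iff.mp hfg
    filter_upwards [h1.eventually_nhds, hg.eventually_analyticAt] with w hw hgw
    refine key w g hgw ?_
    rcases eq_or_ne w z with rfl | hne
    · exact hfg
    · filter_upwards [hw.filter_mono nhdsWithin_le_nhds,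
        nhdsWithin_le_nhds (isOpen_ne.mem_nhds hne)] with u hu hu'
      exact hu hu'
  exact (hg.congr hloc.symm).differentiableAt

/-- A sum of principal parts `c i / (t - p i)` is analytic at `z` as soon as the poles that carry a
nonzero coefficient stay away from `z`. -/
theorem analyticAt_tsum_div_sub {ι : Type*} {c p : ι → ℂ} (hc : Summable c) {z : ℂ} {r : ℝ}
    (hr : 0 < r) (h : ∀ i, c i = 0 ∨ r ≤ ‖p i - z‖) :
    AnalyticAt ℂ (fun t => ∑' i, c i / (t - p i)) z ∧
      ∀ t ∈ Metric.ball z (r / 2), Summable fun i => c i / (t - p i) := by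
  have hdist : ∀ i, c i ≠ 0 → ∀ t ∈ Metric.ball z (r / 2), r / 2 ≤ ‖t - p i‖ := by
    intro i hi t ht
    have h1 := (h i).resolve_left hi
    rw [mem_ball_iff_norm] at ht
    have h2 : ‖p i - z‖ ≤ ‖t - z‖ + ‖t - p i‖ := by
      calc ‖p i - z‖ = ‖(t - z) - (t - p i)‖ := by ring_nf
        _ ≤ _ := norm_sub_le _ _
    linarith
  have hbound : ∀ i, ∀ t ∈ Metric.ball z (r / 2), ‖c i / (t - p i)‖ ≤ ‖c i‖ / (r / 2) := by
    intro i t ht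
    rcases eq_or_ne (c i) 0 with h0 | h0
    · simp [h0]
    · rw [norm_div]
      exact div_le_div_of_nonneg_left (norm_nonneg _) (by positivity) (hdist i h0 t ht)
  have hs : Summable fun i => ‖c i‖ / (r / 2) := hc.norm.div_const _
  refine ⟨?_, fun t ht => Summable.of_norm_bounded hs fun i => hbound i t ht⟩
  have hd := Complex.differentiableOn_tsum_of_summable_norm (F := fun i t => c i / (t - p i)) hs
    (fun i => ?_) Metric.isOpen_ball hbound
  · exact hd.analyticAt (Metric.ball_mem_nhds _ (by positivity))
  · rcases eq_or_ne (c i) 0 with h0 | h0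
    · simp [h0]
    · intro t ht
      have : t - p i ≠ 0 := by
        rw [← norm_pos_iff]
        have := hdist i h0 t ht
        linarith
      have hd : DifferentiableAt ℂ (fun t => c i / (t - p i)) t := by fun_prop (disch := exact this)
      exact hd.differentiableWithinAt

/-- A sum of principal parts minus the one at `p m` has a removable singularity at `p m`. -/
theorem removableAt_tsum_div_sub {ι : Type*} {c p : ι → ℂ} (hc : Summable c) {m : ι} {r : ℝ}
    (hr : 0 < r) (h : ∀ i, i ≠ m → r ≤ ‖p i - p m‖) :
    RemovableAt (fun t => ∑' i, c i / (t - p i) - c m / (t - p m)) (p m) := by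
  classical
  have hc' : Summable (Function.update c m 0) := hc.update m 0
  obtain ⟨h1, h2⟩ := analyticAt_tsum_div_sub (p := p) (z := p m) hc' hr (fun i => by
    rcases eq_or_ne i m with rfl | hi
    · left; simp
    · right; exact h i hi)
  refine ⟨_, h1, ?_⟩
  have hball : Metric.ball (p m) (r / 2) ∈ 𝓝[≠] (p m) :=
    nhdsWithin_le_nhds (Metric.ball_mem_nhds _ (by positivity))
  filter_upwards [hball] with t ht
  have h3 := (h2 t ht).hasSum.add (hasSum_pi_single m (c m / (t - p m)))
  have h4 : (fun i => Function.update c m 0 i / (t - p i)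
      + (Pi.single m (c m / (t - p m)) : ι → ℂ) i) = fun i => c i / (t - p i) := by
    funext i
    rcases eq_or_ne i m with rfl | hi
    · simp
    · simp [hi]
  rw [h4] at h3
  rw [h3.tsum_eq]
  ring

/-- If the poles stay away from the points of the filter `l`, a sum of principal parts behaves at
infinity like `(∑' i, c i) / t`. -/
theorem tendsto_mul_tsum_div_sub {ι : Type*} {c p : ι → ℂ} (hc : Summable c)
    (hcp : Summable fun i => c i * p i) {δ : ℝ} (hδ : 0 < δ) {l : Filter ℂ}
    (hl : l ≤ cocompact ℂ) (h : ∀ᶠ t in l, ∀ i, δ ≤ ‖t - p i‖) :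
    Tendsto (fun t => t * ∑' i, c i / (t - p i)) l (𝓝 (∑' i, c i)) := by
  simp_rw [← tsum_mul_left]
  refine tendsto_tsum_of_dominated_convergence
    (bound := fun i => ‖c i‖ + ‖c i * p i‖ / δ) (hc.norm.add (hcp.norm.div_const _)) ?_ ?_
  · intro i
    have h0 : Tendsto (fun t : ℂ => c i + c i * p i * (t - p i)⁻¹) l (𝓝 (c i + c i * p i * 0)) := by
      refine tendsto_const_nhds.add (tendsto_const_nhds.mul ?_)
      refine (tendsto_inv₀_cobounded.comp ?_)
      rw [← Metric.cobounded_eq_cocompact] at hl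
      refine Tendsto.mono_left ?_ hl
      simp
    rw [mul_zero, add_zero] at h0
    refine h0.congr' ?_
    filter_upwards [h] with t ht
    have : t - p i ≠ 0 := by
      rw [← norm_pos_iff]
      exact hδ.trans_le (ht i)
    field_simp
    ring
  · filter_upwards [h] with t ht i
    have hne : t - p i ≠ 0 := by
      rw [← norm_pos_iff]
      exact hδ.trans_le (ht i)
    have : t * (c i / (t - p i)) = c i + c i * p i / (t - p i) := by
      field_simp
      ring
    rw [this]
    refine (norm_add_le _ _).trans (add_le_add_right ?_ _)
    rw [norm_div]
    exact div_le_div_of_nonneg_left (norm_nonneg _) hδ (ht i)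

end RemovableSingularities

/-! ### The kernel `1 / (1 - exp (-2πix))` -/

section ToddKernel

open Filter Topology

/-- The function `x ↦ 1 / (1 - exp (-2πix)) = 1 / 2 + cot (πx) / (2i)`: it has period `1`, a simple
pole at every integer (where its Lean value is `0`), and it tends to `1` as `Im x → -∞` and to `0`
as `Im x → ∞`. -/
noncomputable def toddKernel (x : ℂ) : ℂ :=
  (1 - Complex.exp (-(2 * Real.pi * Complex.I * x)))⁻¹

theorem toddKernel_add_int (x : ℂ) (n : ℤ) : toddKernel (x + n) = toddKernel x := by
  unfold toddKernel
  congr 2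
  rw [show -(2 * Real.pi * Complex.I * (x + n)) =
    -(2 * Real.pi * Complex.I * x) - n * (2 * Real.pi * Complex.I) by ring]
  exact Complex.exp_periodic.sub_int_mul_eq n

theorem toddKernel_sub_int (x : ℂ) (n : ℤ) : toddKernel (x - n) = toddKernel x := by
  have := toddKernel_add_int (x - n) n
  rwa [sub_add_cancel, eq_comm] at this

theorem one_sub_exp_ne_zero {x : ℂ} (hx : ∀ n : ℤ, x ≠ n) :
    1 - Complex.exp (-(2 * Real.pi * Complex.I * x)) ≠ 0 := by
  intro h
  obtain ⟨n, hn⟩ := Complex.exp_eq_one_iff.mp (sub_eq_zero.mp h).symm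
  apply hx (-n)
  have h2 : (2 * Real.pi * Complex.I : ℂ) ≠ 0 := Complex.two_pi_I_ne_zero
  apply mul_left_cancel₀ h2
  push_cast
  linear_combination -hn

theorem analyticAt_toddKernel {x : ℂ} (hx : ∀ n : ℤ, x ≠ n) : AnalyticAt ℂ toddKernel x := by
  unfold toddKernel
  refine AnalyticAt.inv ?_ (one_sub_exp_ne_zero hx)
  fun_prop

theorem toddKernel_zero : toddKernel 0 = 0 := by
  simp [toddKernel]

/-- The Laurent expansion at `0`; its coefficients are `Bₘ (2πi) ^ (m - 1) / m!` with `B₁ = 1 / 2`. -/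
theorem exists_toddKernel_laurent : ∃ g : ℂ → ℂ, AnalyticAt ℂ g 0 ∧ ∀ᶠ x in 𝓝[≠] (0 : ℂ),
    toddKernel x = 1 / (2 * Real.pi * Complex.I * x) + 1 / 2 + 2 * Real.pi * Complex.I * x / 12
      + x ^ 2 * g x := by
  have hp : (2 * Real.pi * Complex.I : ℂ) ≠ 0 := Complex.two_pi_I_ne_zero
  set p : ℂ := 2 * Real.pi * Complex.I with hp_def
  obtain ⟨F, hF, hexp⟩ := AnalyticAt.exists_eq_sum_add_pow_mul (f := Complex.exp)
    (by fun_prop) 4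
  have hexp' : ∀ x : ℂ, 1 - Complex.exp (-(p * x)) = p * x * (1 - p * x / 2 + (p * x) ^ 2 / 6
      - (p * x) ^ 3 * F (-(p * x))) := by
    intro x
    rw [hexp]
    simp [Finset.sum_range_succ, Nat.factorial, iteratedDeriv_eq_iterate]
    ring
  have hF' : AnalyticAt ℂ (fun x => F (-(p * x))) 0 := by
    apply AnalyticAt.fun_comp _ (by fun_prop)
    simpa using hF
  have hD : AnalyticAt ℂ (fun x => 1 - p * x / 2 + (p * x) ^ 2 / 6
      - (p * x) ^ 3 * F (-(p * x))) 0 :=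
    AnalyticAt.fun_sub (by fun_prop) (AnalyticAt.fun_mul (by fun_prop) hF')
  have hD0 : (fun x => 1 - p * x / 2 + (p * x) ^ 2 / 6 - (p * x) ^ 3 * F (-(p * x))) 0 ≠ 0 := by
    simp
  -- The numerator comes from the terms of order at least three in
  -- `1 - (1 + u / 2 + u ^ 2 / 12) * (1 - exp (-u)) / u`, where `u = p * x`.
  refine ⟨fun x => p ^ 2 * (-1 / 24 - p * x / 72
    + (1 + p * x / 2 + (p * x) ^ 2 / 12) * F (-(p * x))) /
      (1 - p * x / 2 + (p * x) ^ 2 / 6 - (p * x) ^ 3 * F (-(p * x))), ?_, ?_⟩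
  · exact AnalyticAt.fun_div (AnalyticAt.fun_mul (by fun_prop)
      (AnalyticAt.fun_add (by fun_prop) (AnalyticAt.fun_mul (by fun_prop) hF'))) hD hD0
  · filter_upwards [self_mem_nhdsWithin,
      (hD.continuousAt.eventually_ne hD0).filter_mono nhdsWithin_le_nhds] with x hx hDx
    have hx : x ≠ 0 := hx
    unfold toddKernel
    rw [← hp_def, hexp']
    generalize hd : 1 - p * x / 2 + (p * x) ^ 2 / 6 - (p * x) ^ 3 * F (-(p * x)) = d at hDx ⊢
    field_simp
    rw [← hd]
    ring

/-- Near an integer the kernel is a simple pole of residue `1 / (2πi)` plus an analytic function. -/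
theorem exists_toddKernel_mul_eq {ω z : ℂ} (hω : ω ≠ 0) {n : ℤ} (hz : ω * z = n) :
    ∃ g : ℂ → ℂ, AnalyticAt ℂ g z ∧ ∀ᶠ t in 𝓝[≠] z,
      toddKernel (ω * t) = 1 / (2 * Real.pi * Complex.I * ω) / (t - z) + g t := by
  obtain ⟨g, hg, h⟩ := exists_toddKernel_laurent
  have hlim : Tendsto (fun t => ω * (t - z)) (𝓝[≠] z) (𝓝[≠] 0) := by
    apply tendsto_nhdsWithin_of_tendsto_nhds_of_eventually_within
    · have : ContinuousAt (fun t => ω * (t - z)) z := by fun_prop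
      have h0 := this.tendsto.mono_left (nhdsWithin_le_nhds (s := {z}ᶜ))
      simpa using h0
    · filter_upwards [self_mem_nhdsWithin] with t ht
      exact mul_ne_zero hω (sub_ne_zero.mpr ht)
  refine ⟨fun t => 1 / 2 + 2 * Real.pi * Complex.I * (ω * (t - z)) / 12
    + (ω * (t - z)) ^ 2 * g (ω * (t - z)), ?_, ?_⟩
  · have : AnalyticAt ℂ (fun t => g (ω * (t - z))) z := by
      apply AnalyticAt.fun_comp _ (by fun_prop)
      simpa using hg
    exact AnalyticAt.fun_add (by fun_prop) (AnalyticAt.fun_mul (by fun_prop) this)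
  · filter_upwards [hlim.eventually h] with t ht
    rw [← toddKernel_sub_int (ω * t) n, ← hz, ← mul_sub, ht, div_div]
    ring

theorem abs_im_le_norm_sub_int (x : ℂ) (n : ℤ) : |x.im| ≤ ‖x - n‖ := by
  have := Complex.abs_im_le_norm (x - n)
  simpa using this

/-- Away from the integers the kernel is bounded. -/
theorem exists_norm_toddKernel_le : ∃ M : ℝ, 0 < M ∧
    ∀ x : ℂ, (∀ n : ℤ, 1 / 4 ≤ ‖x - n‖) → ‖toddKernel x‖ ≤ M := by
  -- By periodicity it suffices to consider a vertical strip, of which the part `|Im x| ≤ 1` away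
  -- from the integers is compact; the rest is elementary.
  set K : Set ℂ := (Set.Icc 0 1 ×ℂ Set.Icc (-1) 1) ∩ ⋂ n : ℤ, {x : ℂ | 1 / 4 ≤ ‖x - n‖} with hK
  have hKc : IsCompact K := by
    apply IsCompact.inter_right
    · exact isCompact_Icc.reProdIm isCompact_Icc
    · exact isClosed_iInter fun n => isClosed_le continuous_const (by fun_prop)
  have hcont : ContinuousOn toddKernel K := by
    intro x hx
    refine (analyticAt_toddKernel fun n hn => ?_).continuousAt.continuousWithinAt
    have := Set.mem_iInter.mp hx.2 n
    simp [hn] at this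
    norm_num at this
  obtain ⟨M, hM⟩ := hKc.exists_bound_of_continuousOn hcont
  refine ⟨max M 2, by positivity, fun x hx => ?_⟩
  rcases le_or_gt |x.im| 1 with him | him
  · rw [← toddKernel_sub_int x ⌊x.re⌋]
    refine (hM _ ⟨?_, ?_⟩).trans (le_max_left _ _)
    · rw [Complex.mem_reProdIm]
      refine ⟨?_, ?_⟩
      · simp only [Complex.sub_re, Complex.intCast_re, Set.mem_Icc]
        exact ⟨by linarith [Int.floor_le x.re], by linarith [Int.lt_floor_add_one x.re]⟩
      · simpa using abs_le.mp him
    · refine Set.mem_iInter.mpr fun n => ?_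
      have := hx (⌊x.re⌋ + n)
      push_cast at this
      rw [Set.mem_ofPred_eq, sub_sub]
      exact this
  · refine le_trans ?_ (le_max_right _ _)
    have hn : ‖Complex.exp (-(2 * Real.pi * Complex.I * x))‖ = Real.exp (2 * Real.pi * x.im) := by
      rw [Complex.norm_exp]
      congr 1
      simp
    unfold toddKernel
    rw [norm_inv]
    have hpi := Real.pi_gt_three
    have hlow : 1 / 2 ≤ ‖1 - Complex.exp (-(2 * Real.pi * Complex.I * x))‖ := by
      rcases le_or_gt 0 x.im with h0 | h0
      · have h1 := norm_sub_norm_le (Complex.exp (-(2 * Real.pi * Complex.I * x))) 1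
        rw [norm_sub_rev, hn, norm_one] at h1
        rw [abs_of_nonneg h0] at him
        have := Real.add_one_le_exp (2 * Real.pi * x.im)
        nlinarith
      · have h1 := norm_sub_norm_le 1 (Complex.exp (-(2 * Real.pi * Complex.I * x)))
        rw [hn, norm_one] at h1
        rw [abs_of_neg h0] at him
        have h2 := Real.add_one_le_exp (-(2 * Real.pi * x.im))
        have h3 : Real.exp (2 * Real.pi * x.im) ≤ 1 / 2 := by
          rw [← neg_neg (2 * Real.pi * x.im), Real.exp_neg, one_div]
          apply inv_anti₀ two_pos
          nlinarith
        linarith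
    calc _ ≤ (1 / 2 : ℝ)⁻¹ := inv_anti₀ (by norm_num) hlow
      _ = 2 := by norm_num

/-- With the bound for `toddKernel (-x)` this gives exponential decay in the upper half-plane. -/
theorem toddKernel_eq_neg_exp_mul {x : ℂ} (hx : ∀ n : ℤ, x ≠ n) :
    toddKernel x = -Complex.exp (2 * Real.pi * Complex.I * x) * toddKernel (-x) := by
  have h1 := one_sub_exp_ne_zero hx
  have h2 : 1 - Complex.exp (-(2 * Real.pi * Complex.I * -x)) ≠ 0 := by
    refine one_sub_exp_ne_zero fun n hn => hx (-n) ?_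
    push_cast
    rw [← hn, neg_neg]
  unfold toddKernel
  rw [mul_neg, neg_neg] at h2 ⊢
  rw [Complex.exp_neg] at h1 ⊢
  have h3 := Complex.exp_ne_zero (2 * Real.pi * Complex.I * x)
  generalize Complex.exp (2 * Real.pi * Complex.I * x) = e at *
  have h4 : e - 1 ≠ 0 := fun h => h2 (by rw [← neg_sub, h, neg_zero])
  field_simp
  ring

end ToddKernel

/-! ### Bounds for the kernel -/

section KernelBounds

open Filter Topology

theorem ne_intCast_of_im_ne_zero {x : ℂ} (hx : x.im ≠ 0) (n : ℤ) : x ≠ n := by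
  rintro rfl
  simp at hx

theorem exists_norm_toddKernel_le_exp : ∃ M : ℝ, 0 < M ∧ ∀ x : ℂ, (∀ n : ℤ, 1 / 4 ≤ ‖x - n‖) →
    ‖toddKernel x‖ ≤ M ∧ ‖toddKernel x‖ ≤ M * Real.exp (-(2 * Real.pi * x.im)) := by
  obtain ⟨M, hM, h⟩ := exists_norm_toddKernel_le
  refine ⟨M, hM, fun x hx => ⟨h x hx, ?_⟩⟩
  have hx' : ∀ n : ℤ, x ≠ n := by
    rintro n rfl
    have := hx n
    simp at this
    norm_num at this
  have h1 : ‖toddKernel (-x)‖ ≤ M := h (-x) fun n => by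
    have := hx (-n)
    rw [← norm_neg]
    push_cast at this
    rwa [neg_sub, sub_neg_eq_add, add_comm, ← sub_neg_eq_add]
  rw [toddKernel_eq_neg_exp_mul hx', norm_mul, norm_neg, Complex.norm_exp, mul_comm]
  refine mul_le_mul h1 (le_of_eq ?_) (by positivity) hM.le
  congr 1
  simp

theorem toddKernel_nat_mul_neg (n : ℕ) (τ : ℂ) :
    toddKernel (n * -τ) = (1 - Complex.exp (2 * Real.pi * Complex.I * τ) ^ n)⁻¹ := by
  rw [toddKernel, ← Complex.exp_nat_mul]
  ring_nf

theorem toddKernel_nat_mul {n : ℕ} (hn : n ≠ 0) {σ : ℂ} (hσ : 0 < σ.im) :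
    toddKernel (n * σ) = -Complex.exp (2 * Real.pi * Complex.I * σ) ^ n *
      (1 - Complex.exp (2 * Real.pi * Complex.I * σ) ^ n)⁻¹ := by
  rw [toddKernel_eq_neg_exp_mul, ← mul_neg, toddKernel_nat_mul_neg, ← Complex.exp_nat_mul]
  · ring_nf
  · apply ne_intCast_of_im_ne_zero
    simp [hn, hσ.ne']

theorem norm_inv_one_sub_pow_le {q : ℂ} (hq : ‖q‖ < 1) {n : ℕ} (hn : 0 < n) :
    ‖(1 - q ^ n)⁻¹‖ ≤ (1 - ‖q‖)⁻¹ := by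
  rw [norm_inv]
  exact inv_anti₀ (by linarith) (one_sub_norm_le_norm_one_sub_pow hq ⟨n, hn⟩)

theorem summable_nat_pow_mul_toddKernel (m : ℕ) {x y : ℂ} (hx : 0 < x.im) (hy : y.im < 0) :
    Summable fun n : ℕ => (n : ℂ) ^ m * (toddKernel (n * x) * toddKernel (n * y)) := by
  obtain ⟨τ, rfl⟩ : ∃ τ, y = -τ := ⟨-y, (neg_neg y).symm⟩
  have hτ : 0 < τ.im := by simpa using hy
  have hq := norm_exp_two_pi_I_mul_lt_one hτ
  have hr := norm_exp_two_pi_I_mul_lt_one hx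
  have hker : ∀ n : ℕ, 0 < n → toddKernel (n * x) * toddKernel (n * -τ) =
      -Complex.exp (2 * Real.pi * Complex.I * x) ^ n *
        (1 - Complex.exp (2 * Real.pi * Complex.I * x) ^ n)⁻¹ *
        (1 - Complex.exp (2 * Real.pi * Complex.I * τ) ^ n)⁻¹ := fun n hn => by
    rw [toddKernel_nat_mul hn.ne' hx, toddKernel_nat_mul_neg]
  generalize Complex.exp (2 * Real.pi * Complex.I * τ) = q at *
  generalize Complex.exp (2 * Real.pi * Complex.I * x) = r at *
  have hs : Summable fun n : ℕ => (n : ℝ) ^ m * ‖r‖ ^ n * ((1 - ‖r‖)⁻¹ * (1 - ‖q‖)⁻¹) :=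
    (summable_pow_mul_geometric_of_norm_lt_one m
      (show ‖(‖r‖ : ℝ)‖ < 1 by rwa [norm_norm])).mul_right _
  have hq0 : 0 < 1 - ‖q‖ := by linarith
  have hr0 : 0 < 1 - ‖r‖ := by linarith
  refine Summable.of_norm_bounded hs fun n => ?_
  rcases Nat.eq_zero_or_pos n with rfl | hn
  · rw [Nat.cast_zero, zero_mul, toddKernel_zero, zero_mul, mul_zero, norm_zero]
    positivity
  · rw [hker n hn, norm_mul, norm_mul, norm_mul, norm_neg, norm_pow, norm_pow,
      Complex.norm_natCast, mul_assoc (‖r‖ ^ n), ← mul_assoc (_ ^ m)]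
    exact mul_le_mul_of_nonneg_left (mul_le_mul (norm_inv_one_sub_pow_le hr hn)
      (norm_inv_one_sub_pow_le hq hn) (norm_nonneg _) (inv_nonneg.mpr hr0.le)) (by positivity)

theorem summable_int_pow_mul_toddKernel (m : ℕ) {x y : ℂ} (hx : 0 < x.im) (hy : y.im < 0) :
    Summable fun n : ℤ => (n : ℂ) ^ m * (toddKernel (n * x) * toddKernel (n * y)) := by
  apply Summable.of_nat_of_neg
  · simpa using summable_nat_pow_mul_toddKernel m hx hy
  · have := (summable_nat_pow_mul_toddKernel m (x := -y) (y := -x) (by simpa using hy)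
      (by simpa using hx)).mul_left ((-1) ^ m)
    refine this.congr fun n => ?_
    push_cast
    rw [neg_pow (n : ℂ) m]
    ring_nf

end KernelBounds

/-! ### Cyclic triples of directions -/

section CyclicTriples

open Filter Topology

/-- Three complex numbers whose directions are in counterclockwise cyclic order with successive
angles less than `π`; equivalently, `0` is an interior point of their positively oriented
triangle. -/
structure CyclicTriple (a b c : ℂ) : Prop where
  im_div₁ : 0 < (b / a).im
  im_div₂ : 0 < (c / b).im
  im_div₃ : 0 < (a / c).im

theorem im_div_pos_iff {a b : ℂ} (ha : a ≠ 0) :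
    0 < (b / a).im ↔ 0 < b.im * a.re - b.re * a.im := by
  rw [Complex.div_im, ← sub_div]
  exact div_pos_iff_of_pos_right (Complex.normSq_pos.mpr ha)

theorem im_div_neg_of_pos {a b : ℂ} (h : 0 < (b / a).im) : (a / b).im < 0 := by
  have h0 : b / a ≠ 0 := by
    intro h0
    simp [h0] at h
  rw [← inv_div, Complex.inv_im]
  exact div_neg_of_neg_of_pos (by linarith) (Complex.normSq_pos.mpr h0)

namespace CyclicTriple

variable {a b c : ℂ}

theorem rotate (h : CyclicTriple a b c) : CyclicTriple b c a := ⟨h.2, h.3, h.1⟩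

theorem ne_zero (h : CyclicTriple a b c) : a ≠ 0 := by
  rintro rfl
  have := h.im_div₁
  simp at this

/-- In every direction one of the three numbers has positive imaginary part. -/
theorem exists_im_pos (h : CyclicTriple a b c) {t : ℂ} (ht : t ≠ 0) :
    0 < max (max (a * t).im (b * t).im) (c * t).im := by
  by_contra hcon
  rw [not_lt, max_le_iff, max_le_iff] at hcon
  obtain ⟨⟨h1, h2⟩, h3⟩ := hcon
  have hab := (im_div_pos_iff h.ne_zero).mp h.im_div₁
  have hbc := (im_div_pos_iff h.rotate.ne_zero).mp h.im_div₂
  have hca := (im_div_pos_iff h.rotate.rotate.ne_zero).mp h.im_div₃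
  -- `Im (c * conj b) * a + Im (a * conj c) * b + Im (b * conj a) * c = 0`
  have hsum : (c.im * b.re - c.re * b.im) * (a * t).im + (a.im * c.re - a.re * c.im) * (b * t).im
      + (b.im * a.re - b.re * a.im) * (c * t).im = 0 := by
    simp only [Complex.mul_im]
    ring
  have ha0 : (a * t).im = 0 := by nlinarith
  have hb0 : (b * t).im = 0 := by nlinarith
  have hdiv : (b * t / (a * t)).im = 0 := by simp [Complex.div_im, ha0, hb0]
  rw [mul_div_mul_right _ _ ht] at hdiv
  exact h.im_div₁.ne' hdiv

/-- By compactness of the unit circle, the largest of the three imaginary parts grows linearly. -/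
theorem exists_norm_le_im (h : CyclicTriple a b c) : ∃ δ : ℝ, 0 < δ ∧
    ∀ t : ℂ, δ * ‖t‖ ≤ max (max (a * t).im (b * t).im) (c * t).im := by
  obtain ⟨u, hu, hmin⟩ := (isCompact_sphere (0 : ℂ) 1).exists_isMinOn
    (NormedSpace.sphere_nonempty.mpr zero_le_one)
    (f := fun t => max (max (a * t).im (b * t).im) (c * t).im) (by fun_prop)
  have hu0 : u ≠ 0 := by
    rintro rfl
    simp at hu
  refine ⟨_, h.exists_im_pos hu0, fun t => ?_⟩
  rcases eq_or_ne t 0 with rfl | ht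
  · simp
  have hmem : t / ‖t‖ ∈ Metric.sphere (0 : ℂ) 1 := by
    simp [ht]
  have key := hmin hmem
  simp only [Set.mem_ofPred_eq, ← mul_div_assoc, Complex.div_ofReal_im] at key
  have hn : 0 < ‖t‖ := norm_pos_iff.mpr ht
  rwa [max_div_div_right hn.le, max_div_div_right hn.le, le_div_iff₀ hn] at key

end CyclicTriple

end CyclicTriples

/-! ### The triple product and its local behaviour -/

section TripleProduct

open Filter Topology

/-- The meromorphic function whose residues make up the three-term relation. -/
noncomputable def tripleProduct (k : ℕ) (a b c t : ℂ) : ℂ :=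
  t ^ (k - 1) * (toddKernel (a * t) * toddKernel (b * t) * toddKernel (c * t))

/-- The residue of `tripleProduct k a b c` at its pole `n / a`, for `n ≠ 0`. At `n = 0` the value
is `0`, because `toddKernel 0 = 0`. -/
noncomputable def tripleResidue (k : ℕ) (a b c : ℂ) (n : ℤ) : ℂ :=
  (n / a) ^ (k - 1) * (toddKernel (b * (n / a)) * toddKernel (c * (n / a))) /
    (2 * Real.pi * Complex.I * a)

/-- The residue of `tripleProduct k a b c` at the origin, for `k = 1, 2, 3`. -/
noncomputable def originResidue (k : ℕ) (a b c : ℂ) : ℂ :=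
  match k with
  | 1 => ((a ^ 2 + b ^ 2 + c ^ 2) / 12 + (a * b + b * c + c * a) / 4) /
      (2 * Real.pi * Complex.I * (a * b * c))
  | 2 => (a + b + c) / 2 / ((2 * Real.pi * Complex.I) ^ 2 * (a * b * c))
  | 3 => 1 / ((2 * Real.pi * Complex.I) ^ 3 * (a * b * c))
  | _ => 0

theorem tripleProduct_rotate (k : ℕ) (a b c : ℂ) :
    tripleProduct k b c a = tripleProduct k a b c := by
  funext t
  unfold tripleProduct
  ring

theorem tripleResidue_zero (k : ℕ) (a b c : ℂ) : tripleResidue k a b c 0 = 0 := by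
  simp [tripleResidue, toddKernel_zero]

theorem analyticAt_toddKernel_mul {ω z : ℂ} (h : ∀ n : ℤ, ω * z ≠ n) :
    AnalyticAt ℂ (fun t => toddKernel (ω * t)) z :=
  AnalyticAt.fun_comp (analyticAt_toddKernel h) (by fun_prop)

theorem analyticAt_tripleProduct {k : ℕ} {a b c z : ℂ} (ha : ∀ n : ℤ, a * z ≠ n)
    (hb : ∀ n : ℤ, b * z ≠ n) (hc : ∀ n : ℤ, c * z ≠ n) :
    AnalyticAt ℂ (tripleProduct k a b c) z :=
  AnalyticAt.fun_mul (by fun_prop) (((analyticAt_toddKernel_mul ha).fun_mul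
    (analyticAt_toddKernel_mul hb)).fun_mul (analyticAt_toddKernel_mul hc))

theorem CyclicTriple.im_mul_div_ne_zero {a b c : ℂ} (h : CyclicTriple a b c) {n : ℤ} (hn : n ≠ 0) :
    (b * (n / a)).im ≠ 0 ∧ (c * (n / a)).im ≠ 0 := by
  have h1 : ∀ x : ℂ, x * (n / a) = ((n : ℝ) : ℂ) * (x / a) := fun x => by
    push_cast
    ring
  have hn' : (n : ℝ) ≠ 0 := Int.cast_ne_zero.mpr hn
  rw [h1, h1, Complex.im_ofReal_mul, Complex.im_ofReal_mul]
  exact ⟨mul_ne_zero hn' h.im_div₁.ne', mul_ne_zero hn' (im_div_neg_of_pos h.im_div₃).ne⟩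

theorem removableAt_tripleProduct_sub {k : ℕ} {a b c : ℂ} (h : CyclicTriple a b c) {n : ℤ}
    (hn : n ≠ 0) :
    RemovableAt (fun t => tripleProduct k a b c t - tripleResidue k a b c n / (t - n / a))
      (n / a) := by
  have ha := h.ne_zero
  obtain ⟨hb, hc⟩ := h.im_mul_div_ne_zero hn
  set z : ℂ := n / a with hz
  have haz : a * z = n := by
    rw [hz]
    field_simp
  obtain ⟨g, hg, hker⟩ := exists_toddKernel_mul_eq ha haz
  have hR : AnalyticAt ℂ (fun t => t ^ (k - 1) * (toddKernel (b * t) * toddKernel (c * t))) z :=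
    AnalyticAt.fun_mul (by fun_prop)
      ((analyticAt_toddKernel_mul (ne_intCast_of_im_ne_zero hb)).fun_mul
        (analyticAt_toddKernel_mul (ne_intCast_of_im_ne_zero hc)))
  set R : ℂ → ℂ := fun t => t ^ (k - 1) * (toddKernel (b * t) * toddKernel (c * t)) with hR_def
  have hds : AnalyticAt ℂ (dslope R z) z := by
    obtain ⟨p, hp⟩ := hR
    exact ⟨_, hp.has_fpower_series_dslope_fslope⟩
  refine ⟨fun t => 1 / (2 * Real.pi * Complex.I * a) * dslope R z t + g t * R t,
    (analyticAt_const.fun_mul hds).fun_add (hg.fun_mul hR), ?_⟩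
  filter_upwards [hker, self_mem_nhdsWithin] with t ht htz
  have htz : t - z ≠ 0 := sub_ne_zero.mpr htz
  have h1 : R t = R z + (t - z) * dslope R z t := by
    rw [← smul_eq_mul (t - z), sub_smul_dslope]
    ring
  have h2 : tripleProduct k a b c t = toddKernel (a * t) * R t := by
    rw [hR_def, tripleProduct]
    ring
  have h3 : tripleResidue k a b c n = R z / (2 * Real.pi * Complex.I * a) := rfl
  rw [h2, h3, ht, add_mul]
  have h4 : 1 / (2 * Real.pi * Complex.I * a) / (t - z) * R t =
      1 / (2 * Real.pi * Complex.I * a) / (t - z) * R z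
        + 1 / (2 * Real.pi * Complex.I * a) * dslope R z t := by
    rw [h1]
    field_simp
  rw [h4]
  ring

/-- The Laurent expansion of `toddKernel (ω * t)` at `t = 0`. -/
theorem exists_toddKernel_mul_laurent {ω : ℂ} (hω : ω ≠ 0) :
    ∃ g : ℂ → ℂ, AnalyticAt ℂ g 0 ∧ ∀ᶠ t in 𝓝[≠] (0 : ℂ),
      toddKernel (ω * t) = (1 + (2 * Real.pi * Complex.I) * ω / 2 * t
        + ((2 * Real.pi * Complex.I) * ω) ^ 2 / 12 * t ^ 2 + t ^ 3 * g t) /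
          (2 * Real.pi * Complex.I * ω * t) := by
  obtain ⟨g, hg, h⟩ := exists_toddKernel_laurent
  have hlim : Tendsto (fun t => ω * t) (𝓝[≠] 0) (𝓝[≠] 0) := by
    apply tendsto_nhdsWithin_of_tendsto_nhds_of_eventually_within
    · have : ContinuousAt (fun t => ω * t) 0 := by fun_prop
      have h0 := this.tendsto.mono_left (nhdsWithin_le_nhds (s := {0}ᶜ))
      simpa using h0
    · filter_upwards [self_mem_nhdsWithin] with t ht
      exact mul_ne_zero hω ht
  have hg' : AnalyticAt ℂ (fun t => g (ω * t)) 0 := by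
    apply AnalyticAt.fun_comp _ (by fun_prop)
    simpa using hg
  refine ⟨fun t => 2 * Real.pi * Complex.I * ω ^ 3 * g (ω * t), analyticAt_const.fun_mul hg', ?_⟩
  filter_upwards [hlim.eventually h, self_mem_nhdsWithin] with t ht ht0
  have ht0 : t ≠ 0 := ht0
  have hp : (2 * Real.pi * Complex.I : ℂ) ≠ 0 := Complex.two_pi_I_ne_zero
  rw [ht]
  generalize (2 * Real.pi * Complex.I : ℂ) = p at *
  field_simp

/-- The principal part of `tripleProduct k a b c` at the origin. -/
theorem exists_removableAt_tripleProduct_zero {k : ℕ} (hk1 : 1 ≤ k) (hk3 : k ≤ 3) {a b c : ℂ}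
    (ha : a ≠ 0) (hb : b ≠ 0) (hc : c ≠ 0) : ∃ A₂ A₃ : ℂ, RemovableAt (fun t =>
      tripleProduct k a b c t - (originResidue k a b c / t + A₂ / t ^ 2 + A₃ / t ^ 3)) 0 := by
  obtain ⟨ga, hga, hA⟩ := exists_toddKernel_mul_laurent ha
  obtain ⟨gb, hgb, hB⟩ := exists_toddKernel_mul_laurent hb
  obtain ⟨gc, hgc, hC⟩ := exists_toddKernel_mul_laurent hc
  have hp : (2 * Real.pi * Complex.I : ℂ) ≠ 0 := Complex.two_pi_I_ne_zero
  unfold originResidue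
  generalize (2 * Real.pi * Complex.I : ℂ) = p at *
  set K : ℂ := p ^ 3 * (a * b * c) with hK
  have hK0 : K ≠ 0 := by positivity
  set C₁ : ℂ := p * (a + b + c) / 2 with hC₁
  set C₂ : ℂ := p ^ 2 * ((a ^ 2 + b ^ 2 + c ^ 2) / 12 + (a * b + b * c + c * a) / 4) with hC₂
  -- The numerators multiply to `1 + C₁ t + C₂ t ^ 2` up to an analytic multiple of `t ^ 3`.
  obtain ⟨G, hG, hprod⟩ : ∃ G : ℂ → ℂ, AnalyticAt ℂ G 0 ∧ ∀ᶠ t in 𝓝[≠] (0 : ℂ),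
      toddKernel (a * t) * toddKernel (b * t) * toddKernel (c * t) =
        (1 + C₁ * t + C₂ * t ^ 2 + t ^ 3 * G t) / (K * t ^ 3) := by
    have hQ : ∀ (ω : ℂ) {g : ℂ → ℂ}, AnalyticAt ℂ g 0 → AnalyticAt ℂ (fun t => 1 + p * ω / 2 * t
        + (p * ω) ^ 2 / 12 * t ^ 2 + t ^ 3 * g t) 0 := fun ω g hg =>
      AnalyticAt.fun_add (by fun_prop) (AnalyticAt.fun_mul (by fun_prop) hg)
    obtain ⟨F, hF, hNF⟩ : ∃ F : ℂ → ℂ, AnalyticAt ℂ F 0 ∧ ∀ t,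
        (1 + p * a / 2 * t + (p * a) ^ 2 / 12 * t ^ 2 + t ^ 3 * ga t) *
        (1 + p * b / 2 * t + (p * b) ^ 2 / 12 * t ^ 2 + t ^ 3 * gb t) *
        (1 + p * c / 2 * t + (p * c) ^ 2 / 12 * t ^ 2 + t ^ 3 * gc t) =
          1 + C₁ * t + C₂ * t ^ 2 + t ^ 3 * F t := by
      refine ⟨fun t =>
        p ^ 3 * (a * b * c / 8 + (a * b * (a + b) + b * c * (b + c) + c * a * (c + a)) / 24)
        + p ^ 4 * ((a ^ 2 * b ^ 2 + b ^ 2 * c ^ 2 + c ^ 2 * a ^ 2) / 144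
          + a * b * c * (a + b + c) / 48) * t
        + p ^ 5 * (a * b * c * (a * b + b * c + c * a)) / 288 * t ^ 2
        + p ^ 6 * (a ^ 2 * b ^ 2 * c ^ 2) / 1728 * t ^ 3
        + (ga t * ((1 + p * b / 2 * t + (p * b) ^ 2 / 12 * t ^ 2 + t ^ 3 * gb t) *
            (1 + p * c / 2 * t + (p * c) ^ 2 / 12 * t ^ 2 + t ^ 3 * gc t))
          + gb t * ((1 + p * a / 2 * t + (p * a) ^ 2 / 12 * t ^ 2) *
            (1 + p * c / 2 * t + (p * c) ^ 2 / 12 * t ^ 2 + t ^ 3 * gc t))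
          + gc t * ((1 + p * a / 2 * t + (p * a) ^ 2 / 12 * t ^ 2) *
            (1 + p * b / 2 * t + (p * b) ^ 2 / 12 * t ^ 2))), ?_, fun t => ?_⟩
      · refine AnalyticAt.fun_add (by fun_prop) (AnalyticAt.fun_add (AnalyticAt.fun_add ?_ ?_) ?_)
        · exact hga.fun_mul ((hQ b hgb).fun_mul (hQ c hgc))
        · exact hgb.fun_mul (AnalyticAt.fun_mul (by fun_prop) (hQ c hgc))
        · exact hgc.fun_mul (by fun_prop)
      · rw [hC₁, hC₂]
        ring
    refine ⟨F, hF, ?_⟩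
    filter_upwards [hA, hB, hC, self_mem_nhdsWithin] with t h1 h2 h3 ht
    have ht : t ≠ 0 := ht
    rw [h1, h2, h3, ← hNF, hK]
    field_simp
  have hmain : ∀ (m : ℕ) (r A₂ A₃ : ℂ) (q : ℂ → ℂ), AnalyticAt ℂ q 0 → k - 1 = m →
      (∀ t : ℂ, t ≠ 0 → t ^ m * ((1 + C₁ * t + C₂ * t ^ 2) / (K * t ^ 3)) =
        r / t + A₂ / t ^ 2 + A₃ / t ^ 3 + q t) →
      RemovableAt (fun t => tripleProduct k a b c t - (r / t + A₂ / t ^ 2 + A₃ / t ^ 3)) 0 := by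
    intro m r A₂ A₃ q hq hkm hr
    refine ⟨fun t => q t + t ^ m * G t / K, hq.fun_add (by fun_prop (disch := exact hK0)), ?_⟩
    filter_upwards [hprod, self_mem_nhdsWithin] with t h1 ht
    have ht : t ≠ 0 := ht
    have h2 := hr t ht
    rw [tripleProduct, h1, hkm]
    have h3 : t ^ m * ((1 + C₁ * t + C₂ * t ^ 2 + t ^ 3 * G t) / (K * t ^ 3)) =
        t ^ m * ((1 + C₁ * t + C₂ * t ^ 2) / (K * t ^ 3)) + t ^ m * G t / K := by
      field_simp
    rw [h3, h2]
    ring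
  interval_cases k
  · refine ⟨C₁ / K, 1 / K, hmain 0 _ _ _ (fun _ => 0) analyticAt_const rfl fun t ht => ?_⟩
    simp only [hK, hC₂]
    field_simp
    ring
  · refine ⟨1 / K, 0, hmain 1 _ _ _ (fun _ => C₂ / K) analyticAt_const rfl fun t ht => ?_⟩
    simp only [hK, hC₁]
    field_simp
    ring
  · refine ⟨0, 0, hmain 2 _ _ _ (fun t => C₁ / K + C₂ / K * t) (by fun_prop) rfl fun t ht => ?_⟩
    simp only [hK]
    field_simp
    ring

theorem summable_tripleResidue (k : ℕ) {a b c : ℂ} (h : CyclicTriple a b c) :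
    Summable (tripleResidue k a b c) ∧
      Summable fun n : ℤ => tripleResidue k a b c n * (n / a) := by
  have key : ∀ m : ℕ, Summable fun n : ℤ =>
      (n / a) ^ m * (toddKernel (b * (n / a)) * toddKernel (c * (n / a))) := fun m => by
    have := (summable_int_pow_mul_toddKernel m h.im_div₁
      (im_div_neg_of_pos h.im_div₃)).mul_left ((a ^ m)⁻¹)
    refine this.congr fun n => ?_
    rw [div_pow, show b * (n / a) = n * (b / a) by ring, show c * (n / a) = n * (c / a) by ring]
    ring
  refine ⟨(key (k - 1)).div_const _, ?_⟩
  refine ((key (k - 1 + 1)).div_const (2 * Real.pi * Complex.I * a)).congr fun n => ?_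
  rw [tripleResidue, pow_succ]
  ring

end TripleProduct

/-! ### The sum of the residues -/

section ResidueTheorem

open Filter Topology

/-- The points `t` for which `ω * t` has distance at least `1 / 4` from every integer, i.e. that keep
away from the poles of `t ↦ toddKernel (ω * t)`. -/
def farFromPoles (ω : ℂ) : Set ℂ :=
  {t | ∀ n : ℤ, 1 / 4 ≤ ‖ω * t - n‖}

theorem mem_farFromPoles_of_le_abs_im {ω t : ℂ} (h : 1 / 4 ≤ |(ω * t).im|) :
    t ∈ farFromPoles ω :=
  fun n => h.trans (abs_im_le_norm_sub_int _ n)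

theorem ne_intCast_of_mem_farFromPoles {ω t : ℂ} (h : t ∈ farFromPoles ω) (n : ℤ) :
    ω * t ≠ n := by
  intro hn
  have := h n
  rw [hn, sub_self, norm_zero] at this
  norm_num at this

theorem le_norm_sub_of_mem_farFromPoles {ω t : ℂ} (hω : ω ≠ 0) (h : t ∈ farFromPoles ω) (n : ℤ) :
    1 / 4 / ‖ω‖ ≤ ‖t - n / ω‖ := by
  have h1 : ω * t - n = ω * (t - n / ω) := by
    field_simp
  have h2 := h n
  rw [h1, norm_mul] at h2
  rwa [div_le_iff₀' (norm_pos_iff.mpr hω)]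

/-- The neighbourhoods of infinity, restricted to the points that lie outside all the discs of radius
`1 / (4‖a‖)`, `1 / (4‖b‖)`, `1 / (4‖c‖)` around the points `n / a`, `n / b`, `n / c`. -/
noncomputable def farFilter (a b c : ℂ) : Filter ℂ :=
  cocompact ℂ ⊓ 𝓟 (farFromPoles a ∩ farFromPoles b ∩ farFromPoles c)

theorem farFilter_rotate (a b c : ℂ) : farFilter b c a = farFilter a b c := by
  unfold farFilter
  congr 2
  rw [Set.inter_comm, Set.inter_assoc]

theorem tendsto_mul_tripleProduct (k : ℕ) {a b c : ℂ} (h : CyclicTriple a b c) :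
    Tendsto (fun t => t * tripleProduct k a b c t) (farFilter a b c) (𝓝 0) := by
  obtain ⟨M, hM, hbd⟩ := exists_norm_toddKernel_le_exp
  obtain ⟨δ, hδ, him⟩ := h.exists_norm_le_im
  set C : ℝ := 2 * Real.pi * δ with hC
  have hC0 : 0 < C := by positivity
  have hlim : Tendsto (fun t : ℂ => (M ^ 3 / C ^ (k - 1 + 1)) *
      ((C * ‖t‖) ^ (k - 1 + 1) * Real.exp (-(C * ‖t‖)))) (farFilter a b c) (𝓝 0) := by
    have h1 : Tendsto (fun t : ℂ => C * ‖t‖) (farFilter a b c) atTop :=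
      ((tendsto_norm_cocompact_atTop (E := ℂ)).const_mul_atTop hC0).mono_left inf_le_left
    simpa using ((Real.tendsto_pow_mul_exp_neg_atTop_nhds_zero (k - 1 + 1)).comp h1).const_mul
      (M ^ 3 / C ^ (k - 1 + 1))
  refine squeeze_zero_norm' ?_ hlim
  filter_upwards [mem_inf_of_right (mem_principal_self _)] with t ht
  obtain ⟨⟨ha, hb⟩, hc⟩ := ht
  obtain ⟨ha1, ha2⟩ := hbd _ ha
  obtain ⟨hb1, hb2⟩ := hbd _ hb
  obtain ⟨hc1, hc2⟩ := hbd _ hc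
  have hexp : ∀ x : ℂ, δ * ‖t‖ ≤ x.im →
      M * Real.exp (-(2 * Real.pi * x.im)) ≤ M * Real.exp (-(C * ‖t‖)) := fun x hx => by
    refine mul_le_mul_of_nonneg_left (Real.exp_le_exp.mpr (neg_le_neg ?_)) hM.le
    rw [hC, mul_assoc]
    exact mul_le_mul_of_nonneg_left hx (by positivity)
  clear_value C
  have hprod : ‖toddKernel (a * t)‖ * ‖toddKernel (b * t)‖ * ‖toddKernel (c * t)‖ ≤
      M ^ 3 * Real.exp (-(C * ‖t‖)) := by
    have he : 0 ≤ M * Real.exp (-(C * ‖t‖)) := by positivity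
    rcases le_max_iff.mp (him t) with h' | h'
    · rcases le_max_iff.mp h' with h'' | h''
      · calc _ ≤ (M * Real.exp (-(C * ‖t‖))) * M * M := by
              have := ha2.trans (hexp _ h'')
              gcongr
          _ = _ := by ring
      · calc _ ≤ M * (M * Real.exp (-(C * ‖t‖))) * M := by
              have := hb2.trans (hexp _ h'')
              gcongr
          _ = _ := by ring
    · calc _ ≤ M * M * (M * Real.exp (-(C * ‖t‖))) := by
            have := hc2.trans (hexp _ h')
            gcongr
        _ = _ := by ring
  calc ‖t * tripleProduct k a b c t‖ = ‖t‖ ^ (k - 1 + 1) *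
        (‖toddKernel (a * t)‖ * ‖toddKernel (b * t)‖ * ‖toddKernel (c * t)‖) := by
        rw [tripleProduct, norm_mul, norm_mul, norm_pow, norm_mul, norm_mul]
        ring
    _ ≤ ‖t‖ ^ (k - 1 + 1) * (M ^ 3 * Real.exp (-(C * ‖t‖))) := by gcongr
    _ = _ := by
        rw [mul_pow]
        field_simp

theorem tendsto_mul_tsum_tripleResidue (k : ℕ) {a b c : ℂ} (h : CyclicTriple a b c) :
    Tendsto (fun t => t * ∑' n : ℤ, tripleResidue k a b c n / (t - n / a)) (farFilter a b c)
      (𝓝 (∑' n : ℤ, tripleResidue k a b c n)) := by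
  obtain ⟨h1, h2⟩ := summable_tripleResidue k h
  have ha := norm_pos_iff.mpr h.ne_zero
  refine tendsto_mul_tsum_div_sub h1 h2 (δ := 1 / 4 / ‖a‖) (by positivity) inf_le_left ?_
  filter_upwards [mem_inf_of_right (mem_principal_self _)] with t ht n
  exact le_norm_sub_of_mem_farFromPoles h.ne_zero ht.1.1 n

/-- The filter is proper: the ray through `1 / a - 1 / b` avoids all the discs near infinity. -/
theorem CyclicTriple.farFilter_neBot {a b c : ℂ} (h : CyclicTriple a b c) :
    (farFilter a b c).NeBot := by
  set d : ℂ := 1 / a - 1 / b with hd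
  have ha : (a * d).im ≠ 0 := by
    have : a * d = 1 - a / b := by
      have := h.ne_zero
      rw [hd]
      field_simp
    rw [this]
    simpa using (im_div_neg_of_pos h.im_div₁).ne
  have hb : (b * d).im ≠ 0 := by
    have : b * d = b / a - 1 := by
      have := h.rotate.ne_zero
      rw [hd]
      field_simp
    rw [this]
    simpa using h.im_div₁.ne'
  have hc : (c * d).im ≠ 0 := by
    have : c * d = c / a - c / b := by
      rw [hd]
      ring
    rw [this, Complex.sub_im]
    have h1 := im_div_neg_of_pos h.im_div₃
    have h2 := h.im_div₂
    linarith
  have hd0 : d ≠ 0 := by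
    intro h0
    simp [h0] at ha
  have hnat : Tendsto (fun n : ℕ => (n : ℝ)) atTop atTop := tendsto_natCast_atTop_atTop
  have hfar : ∀ ω : ℂ, (ω * d).im ≠ 0 → ∀ᶠ n : ℕ in atTop, (n : ℂ) * d ∈ farFromPoles ω := by
    intro ω hω
    filter_upwards [(hnat.atTop_mul_const (abs_pos.mpr hω)).eventually_ge_atTop (1 / 4)] with n hn
    apply mem_farFromPoles_of_le_abs_im
    rw [show ω * (n * d) = ((n : ℝ) : ℂ) * (ω * d) by push_cast; ring, Complex.im_ofReal_mul,
      abs_mul, Nat.abs_cast]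
    exact hn
  have hlim : Tendsto (fun n : ℕ => (n : ℂ) * d) atTop (farFilter a b c) := by
    refine tendsto_inf.mpr ⟨?_, tendsto_principal.mpr ?_⟩
    · rw [← Metric.cobounded_eq_cocompact, ← tendsto_norm_atTop_iff_cobounded]
      simpa using hnat.atTop_mul_const (norm_pos_iff.mpr hd0)
    · filter_upwards [hfar a ha, hfar b hb, hfar c hc] with n h1 h2 h3
      exact ⟨⟨h1, h2⟩, h3⟩
  exact hlim.neBot

/-- A bound for an entire function outside the discs extends, near infinity, to the discs around the
poles `n / a`: these do not meet the other discs there, so the maximum principle applies. -/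
theorem eventually_norm_le_of_notMem_farFromPoles {a b c : ℂ} (ha : a ≠ 0) (hb : (b / a).im ≠ 0)
    (hc : (c / a).im ≠ 0) {F : ℂ → ℂ} (hF : Differentiable ℂ F) {ε : ℝ}
    (h : ∀ᶠ t in farFilter a b c, ‖F t‖ ≤ ε) :
    ∀ᶠ t in cocompact ℂ, t ∉ farFromPoles a → ‖F t‖ ≤ ε := by
  have hna : 0 < ‖a‖ := norm_pos_iff.mpr ha
  have hnorm : Tendsto (fun t : ℂ => ‖t‖) (cocompact ℂ) atTop := tendsto_norm_cocompact_atTop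
  rw [farFilter, eventually_inf_principal] at h
  obtain ⟨R, hR⟩ : ∃ R : ℝ, ∀ t : ℂ, R ≤ ‖t‖ →
      t ∈ farFromPoles a ∩ farFromPoles b ∩ farFromPoles c → ‖F t‖ ≤ ε := by
    rw [← Metric.cobounded_eq_cocompact, ← comap_norm_atTop, eventually_comap] at h
    obtain ⟨R, hR⟩ := eventually_atTop.mp h
    exact ⟨R, fun t ht => hR ‖t‖ ht t rfl⟩
  have hlin : ∀ ω : ℂ, (ω / a).im ≠ 0 → ∀ᶠ t in cocompact ℂ,
      1 / 4 + ‖ω / a‖ / 4 + |(ω / a).im| / 4 ≤ ‖a‖ * |(ω / a).im| * ‖t‖ := fun ω hω =>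
    (hnorm.const_mul_atTop (mul_pos hna (abs_pos.mpr hω))).eventually_ge_atTop _
  filter_upwards [hlin b hb, hlin c hc, hnorm.eventually_ge_atTop (R + 1 / 2 / ‖a‖)]
    with t htb htc htR hta
  obtain ⟨n, hn⟩ : ∃ n : ℤ, ‖a * t - n‖ < 1 / 4 := by
    simpa [farFromPoles] using hta
  have hscale : ∀ s : ℂ, ‖a * s - n‖ = ‖a‖ * ‖s - n / a‖ := fun s => by
    rw [← norm_mul]
    congr 1
    field_simp
  have hρ : (0 : ℝ) < 1 / 4 / ‖a‖ := by positivity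
  have htball : ‖t - n / a‖ < 1 / 4 / ‖a‖ := by
    rwa [lt_div_iff₀' hna, ← hscale]
  have hnlow : ‖a‖ * ‖t‖ - 1 / 4 ≤ |(n : ℝ)| := by
    have := norm_sub_norm_le (a * t) n
    rw [norm_mul, Complex.norm_intCast] at this
    linarith
  refine Complex.norm_le_of_forall_mem_frontier_norm_le
    (U := Metric.ball ((n : ℂ) / a) (1 / 4 / ‖a‖)) Metric.isBounded_ball hF.diffContOnCl
    (fun s hs => ?_) (subset_closure (mem_ball_iff_norm.mpr htball))
  rw [frontier_ball _ hρ.ne', mem_sphere_iff_norm] at hs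
  have hsn : ‖a * s - n‖ = 1 / 4 := by
    rw [hscale, hs]
    field_simp
  have hother : ∀ ω : ℂ,
      1 / 4 + ‖ω / a‖ / 4 + |(ω / a).im| / 4 ≤ ‖a‖ * |(ω / a).im| * ‖t‖ →
      s ∈ farFromPoles ω := by
    intro ω hω
    apply mem_farFromPoles_of_le_abs_im
    have h1 : ω * s = ((n : ℝ) : ℂ) * (ω / a) + ω / a * (a * s - n) := by
      push_cast
      field_simp
      ring
    have h2 : |(ω / a * (a * s - n)).im| ≤ ‖ω / a‖ / 4 := by
      refine (Complex.abs_im_le_norm _).trans (le_of_eq ?_)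
      rw [norm_mul, hsn]
      ring
    rw [h1, Complex.add_im, Complex.im_ofReal_mul]
    have h3 := abs_sub_abs_le_abs_sub ((n : ℝ) * (ω / a).im) (-(ω / a * (a * s - n)).im)
    rw [sub_neg_eq_add, abs_neg, abs_mul] at h3
    have h4 := mul_le_mul_of_nonneg_right hnlow (abs_nonneg (ω / a).im)
    linarith
  refine hR s ?_ ⟨⟨fun m => ?_, hother b htb⟩, hother c htc⟩
  · have h1 : ‖t‖ ≤ ‖t - n / a‖ + ‖s - n / a‖ + ‖s‖ := by
      calc ‖t‖ = ‖(t - n / a) - (s - n / a) + s‖ := by ring_nf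
        _ ≤ _ := (norm_add_le _ _).trans (add_le_add_left (norm_sub_le _ _) _)
    have h2 : 1 / 2 / ‖a‖ = 1 / 4 / ‖a‖ + 1 / 4 / ‖a‖ := by ring
    linarith
  · rcases eq_or_ne m n with rfl | hmn
    · exact hsn.ge
    · have h1 : (1 : ℝ) ≤ ‖(m : ℂ) - n‖ := by
        rw [← Int.cast_sub, Complex.norm_intCast]
        exact_mod_cast Int.one_le_abs (sub_ne_zero.mpr hmn)
      have h2 : ‖(m : ℂ) - n‖ ≤ ‖a * s - n‖ + ‖a * s - m‖ := by
        calc ‖(m : ℂ) - n‖ = ‖(a * s - n) - (a * s - m)‖ := by ring_nf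
          _ ≤ _ := norm_sub_le _ _
      linarith

/-- Liouville's theorem, with decay required only outside the discs around the poles. -/
theorem CyclicTriple.eq_zero_of_tendsto_farFilter {a b c : ℂ} (h : CyclicTriple a b c) {F : ℂ → ℂ}
    (hF : Differentiable ℂ F) (hlim : Tendsto F (farFilter a b c) (𝓝 0)) (z : ℂ) : F z = 0 := by
  refine hF.apply_eq_of_tendsto_cocompact z ?_
  rw [Metric.tendsto_nhds]
  intro ε hε
  have hsmall : ∀ᶠ t in farFilter a b c, ‖F t‖ ≤ ε / 2 := by
    filter_upwards [Metric.tendsto_nhds.mp hlim (ε / 2) (by positivity)] with t ht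
    rw [dist_zero_right] at ht
    exact ht.le
  have hone : ∀ {a b c : ℂ}, CyclicTriple a b c → (∀ᶠ t in farFilter a b c, ‖F t‖ ≤ ε / 2) →
      ∀ᶠ t in cocompact ℂ, t ∉ farFromPoles a → ‖F t‖ ≤ ε / 2 := fun h' =>
    eventually_norm_le_of_notMem_farFromPoles h'.ne_zero h'.im_div₁.ne'
      (im_div_neg_of_pos h'.im_div₃).ne hF
  have h1 := hone h hsmall
  have h2 := hone h.rotate (by rwa [farFilter_rotate])
  have h3 := hone h.rotate.rotate (by rwa [farFilter_rotate, farFilter_rotate])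
  rw [farFilter, eventually_inf_principal] at hsmall
  filter_upwards [h1, h2, h3, hsmall] with t ha hb hc ht
  rw [dist_zero_right]
  refine lt_of_le_of_lt ?_ (half_lt_self hε)
  by_cases hta : t ∈ farFromPoles a
  · by_cases htb : t ∈ farFromPoles b
    · by_cases htc : t ∈ farFromPoles c
      · exact ht ⟨⟨hta, htb⟩, htc⟩
      · exact hc htc
    · exact hb htb
  · exact ha hta

theorem exists_pos_le_norm_div_sub {ω : ℂ} (hω : ω ≠ 0) (z : ℂ) :
    ∃ r : ℝ, 0 < r ∧ ∀ n : ℤ, (n : ℂ) / ω ≠ z → r ≤ ‖n / ω - z‖ := by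
  have hemb : IsClosedEmbedding fun n : ℤ => ((n : ℝ) : ℂ) :=
    Complex.isometry_ofReal.isClosedEmbedding.comp Int.isClosedEmbedding_coe_real
  have hclosed := hemb.isClosedMap {n : ℤ | (n : ℂ) / ω ≠ z} (isClosed_discrete _)
  have hmem : ω * z ∈ ((fun n : ℤ => ((n : ℝ) : ℂ)) '' {n : ℤ | (n : ℂ) / ω ≠ z})ᶜ := by
    rintro ⟨n, hn, hnz⟩
    apply hn
    simp only [Complex.ofReal_intCast] at hnz
    rw [hnz]
    field_simp
  obtain ⟨ε, hε, hball⟩ := Metric.isOpen_iff.mp hclosed.isOpen_compl _ hmem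
  refine ⟨ε / ‖ω‖, div_pos hε (norm_pos_iff.mpr hω), fun n hn => ?_⟩
  by_contra! hlt
  have hnball : (n : ℂ) ∉ Metric.ball (ω * z) ε := fun hmem' => hball hmem' ⟨n, hn, by simp⟩
  apply hnball
  rw [mem_ball_iff_norm]
  have : (n : ℂ) - ω * z = ω * (n / ω - z) := by
    field_simp
  rw [this, norm_mul]
  rwa [lt_div_iff₀' (norm_pos_iff.mpr hω)] at hlt

/-- The sum of the principal parts of `tripleProduct k a b c` at its poles `n / a`, `n ≠ 0`. -/
noncomputable def principalSum (k : ℕ) (a b c t : ℂ) : ℂ :=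
  ∑' n : ℤ, tripleResidue k a b c n / (t - n / a)

theorem analyticAt_principalSum (k : ℕ) {a b c : ℂ} (h : CyclicTriple a b c) {z : ℂ}
    (hz : ∀ n : ℤ, n ≠ 0 → a * z ≠ n) : AnalyticAt ℂ (principalSum k a b c) z := by
  obtain ⟨r, hr, hsep⟩ := exists_pos_le_norm_div_sub h.ne_zero z
  refine (analyticAt_tsum_div_sub (summable_tripleResidue k h).1 hr fun n => ?_).1
  rcases eq_or_ne n 0 with rfl | hn
  · exact Or.inl (tripleResidue_zero k a b c)
  · refine Or.inr (hsep n fun hnz => hz n hn ?_)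
    rw [← hnz, mul_div_cancel₀ _ h.ne_zero]

theorem removableAt_principalSum_sub (k : ℕ) {a b c : ℂ} (h : CyclicTriple a b c) (m : ℤ) :
    RemovableAt (fun t => principalSum k a b c t - tripleResidue k a b c m / (t - m / a))
      (m / a) := by
  obtain ⟨r, hr, hsep⟩ := exists_pos_le_norm_div_sub h.ne_zero (m / a)
  refine removableAt_tsum_div_sub (p := fun n : ℤ => (n : ℂ) / a) (summable_tripleResidue k h).1 hr
    fun n hn => hsep n fun heq => hn ?_
  rw [div_left_inj' h.ne_zero] at heq
  exact_mod_cast heq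

/-- The function left over after subtraction of the principal parts has no pole at `n / a`. -/
theorem removableAt_sub_principalSum (k : ℕ) {a b c : ℂ} (h : CyclicTriple a b c) {n : ℤ}
    (hn : n ≠ 0) {Q : ℂ → ℂ} (hQ : AnalyticAt ℂ Q (n / a)) :
    RemovableAt (fun t => tripleProduct k a b c t - Q t -
      (principalSum k a b c t + principalSum k b c a t + principalSum k c a b t)) (n / a) := by
  obtain ⟨hb, hc⟩ := h.im_mul_div_ne_zero hn
  have hPb := analyticAt_principalSum k h.rotate fun m _ => ne_intCast_of_im_ne_zero hb m
  have hPc := analyticAt_principalSum k h.rotate.rotate fun m _ => ne_intCast_of_im_ne_zero hc m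
  have hmain := ((removableAt_tripleProduct_sub (k := k) h hn).sub
    (removableAt_principalSum_sub k h n)).sub ((hQ.fun_add hPb).fun_add hPc).removableAt
  convert hmain using 2 with t
  ring

/-- The residues of `tripleProduct k a b c` add up to zero. -/
theorem CyclicTriple.sum_residues_eq_zero {k : ℕ} (hk1 : 1 ≤ k) (hk3 : k ≤ 3) {a b c : ℂ}
    (h : CyclicTriple a b c) :
    originResidue k a b c + (∑' n : ℤ, tripleResidue k a b c n + ∑' n : ℤ, tripleResidue k b c a n
      + ∑' n : ℤ, tripleResidue k c a b n) = 0 := by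
  obtain ⟨A₂, A₃, hzero⟩ := exists_removableAt_tripleProduct_zero hk1 hk3 h.ne_zero
    h.rotate.ne_zero h.rotate.rotate.ne_zero
  set A := originResidue k a b c
  set Q : ℂ → ℂ := fun t => A / t + A₂ / t ^ 2 + A₃ / t ^ 3 with hQ
  have hQan : ∀ z, z ≠ 0 → AnalyticAt ℂ Q z := fun z hz => by
    have h2 : z ^ 2 ≠ 0 := pow_ne_zero _ hz
    have h3 : z ^ 3 ≠ 0 := pow_ne_zero _ hz
    fun_prop (disch := assumption)
  set P : ℂ → ℂ := fun t =>
    principalSum k a b c t + principalSum k b c a t + principalSum k c a b t with hP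
  set E : ℂ → ℂ := fun t => tripleProduct k a b c t - Q t - P t with hE
  have hPan : ∀ z, (∀ n : ℤ, n ≠ 0 → a * z ≠ n) → (∀ n : ℤ, n ≠ 0 → b * z ≠ n) →
      (∀ n : ℤ, n ≠ 0 → c * z ≠ n) → AnalyticAt ℂ P z := fun z h1 h2 h3 =>
    ((analyticAt_principalSum k h h1).fun_add (analyticAt_principalSum k h.rotate h2)).fun_add
      (analyticAt_principalSum k h.rotate.rotate h3)
  have hEan : ∀ z, z ≠ 0 → (∀ n : ℤ, a * z ≠ n) → (∀ n : ℤ, b * z ≠ n) → (∀ n : ℤ, c * z ≠ n) →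
      AnalyticAt ℂ E z := fun z hz h1 h2 h3 =>
    ((analyticAt_tripleProduct h1 h2 h3).fun_sub (hQan z hz)).fun_sub
      (hPan z (fun n _ => h1 n) (fun n _ => h2 n) (fun n _ => h3 n))
  have hpole : ∀ {ω z : ℂ} {n : ℤ}, ω ≠ 0 → z ≠ 0 → ω * z = n → n ≠ 0 ∧ z = n / ω := by
    intro ω z n hω hz hn
    refine ⟨?_, ?_⟩
    · rintro rfl
      exact mul_ne_zero hω hz (by simpa using hn)
    · rw [← hn]
      field_simp
  have hrem : ∀ z, RemovableAt E z := by
    intro z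
    rcases eq_or_ne z 0 with rfl | hz
    · have h0 : ∀ ω : ℂ, ∀ n : ℤ, n ≠ 0 → ω * 0 ≠ n := fun ω n hn => by
        rw [mul_zero]
        exact_mod_cast hn.symm
      exact hzero.sub (hPan 0 (h0 a) (h0 b) (h0 c)).removableAt
    by_cases h1 : ∃ n : ℤ, a * z = n
    · obtain ⟨n, hn⟩ := h1
      obtain ⟨hn0, rfl⟩ := hpole h.ne_zero hz hn
      exact removableAt_sub_principalSum k h hn0 (hQan _ hz)
    by_cases h2 : ∃ n : ℤ, b * z = n
    · obtain ⟨n, hn⟩ := h2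
      obtain ⟨hn0, rfl⟩ := hpole h.rotate.ne_zero hz hn
      have := removableAt_sub_principalSum k h.rotate hn0 (hQan _ hz)
      rw [tripleProduct_rotate] at this
      convert this using 2 with t
      rw [hE, hP]
      ring
    by_cases h3 : ∃ n : ℤ, c * z = n
    · obtain ⟨n, hn⟩ := h3
      obtain ⟨hn0, rfl⟩ := hpole h.rotate.rotate.ne_zero hz hn
      have := removableAt_sub_principalSum k h.rotate.rotate hn0 (hQan _ hz)
      rw [tripleProduct_rotate, tripleProduct_rotate] at this
      convert this using 2 with t
      rw [hE, hP]
      ring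
    push Not at h1 h2 h3
    exact (hEan z hz h1 h2 h3).removableAt
  have hne : ∀ᶠ t in farFilter a b c, t ≠ 0 := by
    have : ∀ᶠ t in cocompact ℂ, t ≠ 0 := by
      filter_upwards [(tendsto_norm_cocompact_atTop (E := ℂ)).eventually_gt_atTop 0] with t ht
      exact norm_pos_iff.mp ht
    exact this.filter_mono inf_le_left
  have hinv : Tendsto (fun t : ℂ => t⁻¹) (farFilter a b c) (𝓝 0) := by
    refine tendsto_inv₀_cobounded.mono_left ?_
    rw [Metric.cobounded_eq_cocompact]
    exact inf_le_left
  have hQlim : Tendsto (fun t => t * Q t) (farFilter a b c) (𝓝 A) := by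
    have h1 : Tendsto (fun t : ℂ => A + A₂ * t⁻¹ + A₃ * t⁻¹ ^ 2) (farFilter a b c)
        (𝓝 (A + A₂ * 0 + A₃ * 0 ^ 2)) :=
      (tendsto_const_nhds.add (hinv.const_mul _)).add ((hinv.pow 2).const_mul _)
    simp only [mul_zero, add_zero, ne_eq, OfNat.ofNat_ne_zero, not_false_eq_true, zero_pow] at h1
    refine h1.congr' ?_
    filter_upwards [hne] with t ht
    rw [hQ]
    field_simp
  set S : ℂ := ∑' n : ℤ, tripleResidue k a b c n + ∑' n : ℤ, tripleResidue k b c a n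
      + ∑' n : ℤ, tripleResidue k c a b n with hS
  have hPlim : Tendsto (fun t => t * P t) (farFilter a b c) (𝓝 S) := by
    have h1 := tendsto_mul_tsum_tripleResidue k h
    have h2 := tendsto_mul_tsum_tripleResidue k h.rotate
    have h3 := tendsto_mul_tsum_tripleResidue k h.rotate.rotate
    rw [farFilter_rotate] at h2 h3
    rw [farFilter_rotate] at h3
    refine ((h1.add h2).add h3).congr fun t => ?_
    rw [hP]
    simp only [principalSum]
    ring
  have hElim : Tendsto (fun t => t * E t) (farFilter a b c) (𝓝 (-(A + S))) := by
    have := ((tendsto_mul_tripleProduct k h).sub hQlim).sub hPlim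
    rw [show 0 - A - S = -(A + S) by ring] at this
    refine this.congr fun t => ?_
    rw [hE]
    ring
  obtain ⟨F, hF, hFE⟩ := exists_differentiable_of_removableAt hrem
  have hEF : ∀ᶠ t in farFilter a b c, F t = E t := by
    filter_upwards [hne, mem_inf_of_right (mem_principal_self _)] with t ht0 ht
    exact hFE t (hEan t ht0 (ne_intCast_of_mem_farFromPoles ht.1.1)
      (ne_intCast_of_mem_farFromPoles ht.1.2) (ne_intCast_of_mem_farFromPoles ht.2))
  have hFlim : Tendsto F (farFilter a b c) (𝓝 0) := by
    have := hinv.mul hElim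
    rw [zero_mul] at this
    refine this.congr' ?_
    filter_upwards [hne, hEF] with t ht0 ht
    rw [ht, inv_mul_cancel_left₀ ht0]
  have hF0 := h.eq_zero_of_tendsto_farFilter hF hFlim
  have := h.farFilter_neBot
  have hlim0 : Tendsto (fun t => t * E t) (farFilter a b c) (𝓝 0) := by
    refine tendsto_const_nhds.congr' ?_
    filter_upwards [hEF] with t ht
    rw [← ht, hF0, mul_zero]
  exact neg_eq_zero.mp (tendsto_nhds_unique hElim hlim0)

end ResidueTheorem

/-! ### Relations between elliptic zeta values -/

section EllipticZeta

theorem ellipticZetaTerm_add (k : ℕ) {τ σ : ℂ} (hτ : 0 < τ.im) (hσ : 0 < σ.im) (j : ℕ+) :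
    ellipticZetaTerm k τ σ j =
      ellipticZetaTerm k τ (τ + σ) j + ellipticZetaTerm k (τ + σ) σ j := by
  have hτσ : 0 < (τ + σ).im := by simpa using add_pos hτ hσ
  have hne : ∀ {x : ℂ}, 0 < x.im → 1 - Complex.exp (2 * Real.pi * Complex.I * x) ^ (j : ℕ) ≠ 0 := by
    intro x hx
    have h1 := norm_exp_two_pi_I_mul_lt_one hx
    have h2 := one_sub_norm_le_norm_one_sub_pow h1 j
    rw [← norm_pos_iff]
    linarith
  have h1 := hne hτ
  have h2 := hne hσ
  have h3 := hne hτσ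
  unfold ellipticZetaTerm
  have hmul : Complex.exp (2 * Real.pi * Complex.I * (τ + σ)) ^ (j : ℕ) =
      Complex.exp (2 * Real.pi * Complex.I * τ) ^ (j : ℕ) *
        Complex.exp (2 * Real.pi * Complex.I * σ) ^ (j : ℕ) := by
    rw [mul_add, Complex.exp_add, mul_pow]
  rw [hmul] at h3 ⊢
  generalize Complex.exp (2 * Real.pi * Complex.I * τ) ^ (j : ℕ) = x at *
  generalize Complex.exp (2 * Real.pi * Complex.I * σ) ^ (j : ℕ) = y at *
  rw [← mul_add]
  congr 1
  rcases neg_one_pow_eq_or ℂ k with hk | hk <;> rw [hk] <;> field_simp <;> ring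

theorem ellipticZeta_add (k : ℕ) {τ σ : ℂ} (hτ : 0 < τ.im) (hσ : 0 < σ.im) :
    ellipticZeta k τ σ = ellipticZeta k τ (τ + σ) + ellipticZeta k (τ + σ) σ := by
  have hτσ : 0 < (τ + σ).im := by simpa using add_pos hτ hσ
  unfold ellipticZeta
  rw [← mul_add, ← (summable_ellipticZetaTerm k hτ hτσ).tsum_add
    (summable_ellipticZetaTerm k hτσ hσ)]
  exact congrArg _ (tsum_congr fun j => ellipticZetaTerm_add k hτ hσ j)

theorem ellipticZeta_swap (k : ℕ) (τ σ : ℂ) :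
    ellipticZeta k σ τ = -(-1) ^ k * ellipticZeta k τ σ := by
  have hterm : ∀ j, ellipticZetaTerm k σ τ j = -(-1) ^ k * ellipticZetaTerm k τ σ j := by
    intro j
    unfold ellipticZetaTerm
    rw [mul_comm (1 - Complex.exp (2 * Real.pi * Complex.I * σ) ^ (j : ℕ))]
    rcases neg_one_pow_eq_or ℂ k with hk | hk <;> rw [hk] <;> ring
  unfold ellipticZeta
  simp_rw [hterm]
  rw [tsum_mul_left]
  ring

/-- The residues at `n` and `-n` combine to one term of the elliptic zeta series. -/
theorem tsum_tripleResidue {k : ℕ} (hk : 1 ≤ k) {a b c : ℂ} (h : CyclicTriple a b c) :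
    ∑' n : ℤ, tripleResidue k a b c n =
      -(-1) ^ k * ((k - 1).factorial / (2 * Real.pi * Complex.I) ^ (k + 1)) *
        (ellipticZeta k (-c / a) (b / a) / a ^ k) := by
  have hb := h.im_div₁
  have hc : 0 < (-c / a).im := by
    have := im_div_neg_of_pos h.im_div₃
    rw [neg_div, Complex.neg_im]
    linarith
  have ha := h.ne_zero
  have hp : (2 * Real.pi * Complex.I : ℂ) ≠ 0 := Complex.two_pi_I_ne_zero
  obtain ⟨m, rfl⟩ : ∃ m, k = m + 1 := ⟨k - 1, by omega⟩
  have hterm : ∀ n : ℤ, tripleResidue (m + 1) a b c n = (2 * Real.pi * Complex.I * a ^ (m + 1))⁻¹ *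
      (n ^ m * (toddKernel (n * (b / a)) * toddKernel (n * -(-c / a)))) := by
    intro n
    rw [tripleResidue, Nat.add_sub_cancel, div_pow, show b * (n / a) = n * (b / a) by ring,
      show c * (n / a) = n * -(-c / a) by ring]
    field_simp
    ring
  have hs : Summable fun n : ℤ =>
      (n : ℂ) ^ m * (toddKernel (n * (b / a)) * toddKernel (n * -(-c / a))) :=
    summable_int_pow_mul_toddKernel m hb (by simpa using hc)
  simp_rw [hterm]
  rw [tsum_mul_left]
  generalize b / a = σ at *
  generalize -c / a = τ at *
  have hsum : ∑' n : ℤ, (n : ℂ) ^ m * (toddKernel (n * σ) * toddKernel (n * -τ)) =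
      (-1) ^ (m + 1) * ∑' j, ellipticZetaTerm (m + 1) τ σ j := by
    have hpos : Summable fun j : ℕ+ =>
        ((j : ℤ) : ℂ) ^ m * (toddKernel ((j : ℤ) * σ) * toddKernel ((j : ℤ) * -τ)) :=
      hs.comp_injective (i := fun j : ℕ+ => (j : ℤ)) (fun i j hij => by simpa using hij)
    have hneg : Summable fun j : ℕ+ => ((-(j : ℤ) : ℤ) : ℂ) ^ m *
        (toddKernel ((-(j : ℤ) : ℤ) * σ) * toddKernel ((-(j : ℤ) : ℤ) * -τ)) :=
      hs.comp_injective (i := fun j : ℕ+ => -(j : ℤ)) (fun i j hij => by simpa using hij)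
    rw [tsum_int_eq_zero_add_tsum_pnat hs, Int.cast_zero, zero_mul, toddKernel_zero, zero_mul,
      mul_zero, zero_add, ← hpos.tsum_add hneg, ← tsum_mul_left]
    refine tsum_congr fun j => ?_
    have h1 := toddKernel_nat_mul j.ne_zero hb
    have h2 := toddKernel_nat_mul_neg j τ
    have h3 := toddKernel_nat_mul j.ne_zero hc
    have h4 := toddKernel_nat_mul_neg j σ
    push_cast
    rw [show -((j : ℕ) : ℂ) * σ = (j : ℕ) * -σ by ring,
      show -((j : ℕ) : ℂ) * -τ = (j : ℕ) * τ by ring, h1, h2, h3, h4, ellipticZetaTerm, Nat.add_sub_cancel,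
      neg_pow ((j : ℕ) : ℂ), div_eq_mul_inv, mul_inv, pow_succ]
    rcases neg_one_pow_eq_or ℂ m with hk | hk <;> rw [hk] <;> ring
  have hfac : (m.factorial : ℂ) ≠ 0 := Nat.cast_ne_zero.mpr m.factorial_ne_zero
  rw [hsum, ellipticZeta, Nat.add_sub_cancel]
  field_simp
  ring

end EllipticZeta

theorem theorem3 (k : ℕ) (hk1 : 1 ≤ k) (hk3 : k ≤ 3) (τ σ : ℂ)
    (hτ : 0 < τ.im) (hσ : 0 < σ.im) (hστ : 0 < (σ / τ).im) :
    ellipticZeta k τ σ = ellipticZeta k τ (τ + σ) + ellipticZeta k (τ + σ) σ ∧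
    ellipticZeta k τ σ =
      τ ^ (-(k : ℤ)) * ellipticZeta k (-1 / τ) (σ / τ)
        + (-σ) ^ (-(k : ℤ)) * ellipticZeta k (-τ / σ) (-1 / σ)
        + Complex.I * Real.pi * exceptionalCorrection k τ σ := by
  refine ⟨ellipticZeta_add k hτ hσ, ?_⟩
  have hτ0 : τ ≠ 0 := by
    rintro rfl
    simp at hτ
  have hσ0 : σ ≠ 0 := by
    rintro rfl
    simp at hσ
  have h : CyclicTriple 1 σ (-τ) := by
    refine ⟨by simpa using hσ, ?_, ?_⟩
    · rw [neg_div, Complex.neg_im]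
      linarith [im_div_neg_of_pos hστ]
    · have h1 : 0 < (τ / 1).im := by simpa using hτ
      rw [div_neg, Complex.neg_im]
      linarith [im_div_neg_of_pos h1]
  have hres := h.sum_residues_eq_zero hk1 hk3
  rw [tsum_tripleResidue hk1 h, tsum_tripleResidue hk1 h.rotate,
    tsum_tripleResidue hk1 h.rotate.rotate] at hres
  rw [show -(-τ) / 1 = τ by ring, div_one, show -σ / -τ = σ / τ by rw [neg_div_neg_eq],
    show 1 / -τ = -1 / τ by rw [div_neg, neg_div],
    ellipticZeta_swap k (-τ / σ) (-1 / σ), ellipticZeta_swap k (-1 / τ) (σ / τ)] at hres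
  rw [zpow_neg, zpow_neg, zpow_natCast, zpow_natCast]
  generalize ellipticZeta k τ σ = Z₁ at *
  generalize ellipticZeta k (-1 / τ) (σ / τ) = Z₂ at *
  generalize ellipticZeta k (-τ / σ) (-1 / σ) = Z₃ at *
  have hp : (2 * Real.pi * Complex.I : ℂ) ≠ 0 := Complex.two_pi_I_ne_zero
  have hIpi : Complex.I * Real.pi = (2 * Real.pi * Complex.I) / 2 := by ring
  rw [hIpi]
  unfold originResidue at hres
  generalize (2 * Real.pi * Complex.I : ℂ) = p at *
  interval_cases k
  · simp only [Nat.sub_self, Nat.factorial_zero, Nat.cast_one] at hres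
    simp only [exceptionalCorrection]
    linear_combination (norm := skip) (p ^ 2) * hres
    field_simp
    ring
  · simp only [Nat.add_one_sub_one, Nat.factorial_one, Nat.cast_one] at hres
    simp only [exceptionalCorrection]
    linear_combination (norm := skip) (-p ^ 3) * hres
    field_simp
    ring
  · simp only [Nat.reduceSub, Nat.factorial_two, Nat.cast_ofNat] at hres
    simp only [exceptionalCorrection]
    linear_combination (norm := skip) (p ^ 4 / 2) * hres
    field_simp
    ring
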